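/- Let $\gamma$ be Euler's constant and, for $y>0$, let $\mathrm{Ci}(y)=-\int_y^\infty \frac{\cos t}{t}\,dt$ be the cosine integral, the integral being the (existing) limit of $\int_y^T \frac{\cos t}{t}\,dt$ as $T\to\infty$. Then Kummer's Fourier series holds: for every real $x$ with $0<x<1$, $$\log\Gamma(x)=\frac12\log(2\pi)+\sum_{n=1}^{\infty}\left[\frac{1}{2n}\cos(2n\pi x)+\frac{\gamma+\log(2n\pi)}{n\pi}\sin(2n\pi x)\right],$$ where the series converges in the sense of its partial sums $\sum_{n=1}^N$. Moreover, $$\lim_{y\to0^+}\left[\cos y\,\mathrm{Ci}(y)-\log y\right]=\gamma .$$ -/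

import Mathlib

open Filter Topology

/-- The cosine integral `Ci x = - ∫_x^∞ cos t / t dt` (for `x > 0`), where the integral is an
improper, conditionally convergent one: the limit of `∫_x^T cos t / t dt` as `T → ∞`. -/
noncomputable def cosIntegral (x : ℝ) : ℝ :=
  -limUnder atTop (fun T : ℝ => ∫ t in x..T, Real.cos t / t)

/-!
The series is the Fourier series of `log Γ` on `(0, 1)`. Since `log Γ` is integrable there and
differentiable at every interior point, Dini's test
(`tendsto_fourierPartialSum_of_differentiableAt`), a consequence of the Riemann–Lebesgue lemma,
gives pointwise convergence of the partial sums. It remains to compute the coefficients.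

The mean and the cosine coefficients only see the part of `log Γ` that is symmetric about `1 / 2`,
which by the reflection formula is `(log π - log sin (π x)) / 2`; they follow from the integral of
`log sin` and one integration by parts (`integral_log_Gamma`, `two_mul_integral_log_Gamma_mul_cos`).

For the sine coefficients, `log Γ` is replaced by the Euler approximations
`x log m + log m! - ∑_{k ≤ m} log (x + k)`, which converge uniformly on `(0, 1]`. Periodicity of
the sine unfolds the sum into an integral of `log x sin (2 π n x)` over `[0, m + 1]`, and an
integration by parts expresses this through `Cin T = ∫_0^T (1 - cos t) / t dt` at
`T = 2 π n (m + 1)`. The constant `γ` enters by the asymptotics `Cin T = log T + γ + o(1)`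
(`tendsto_cosIntegralEntire_sub_log`).

The same asymptotics yield the existence of the improper integral and the formula
`Ci y = γ + log y - Cin y` (`cosIntegral_eq`), from which the limit at `0` is immediate because
`(1 - cos y) log y → 0`.
-/

section

open MeasureTheory intervalIntegral Set

/-! ### The Riemann–Lebesgue lemma on an interval and Dini's test -/

/-- No integrability is needed: a non-integrable `f` makes all the integrals `0`. -/
theorem tendsto_intervalIntegral_mul_cexp {f : ℝ → ℝ} {a b : ℝ} (hab : a ≤ b) :
    Tendsto (fun w : ℝ => ∫ t in a..b, Complex.exp (↑(-(w * t)) * Complex.I) * (f t : ℂ))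
      atTop (𝓝 0) := by
  -- The whole-line lemma uses the character `v ↦ exp (2 π i v)`, hence the rescaling by `2 π`.
  have h := (Real.tendsto_integral_exp_smul_cocompact
    ((Ioc a b).indicator fun t => (f t : ℂ))).mono_left _root_.atTop_le_cocompact
  have hc : Tendsto (fun w : ℝ => w / (2 * Real.pi)) atTop atTop :=
    tendsto_id.atTop_div_const (by positivity)
  refine (h.comp hc).congr fun w => ?_
  rw [integral_of_le hab, ← MeasureTheory.integral_indicator measurableSet_Ioc]
  refine integral_congr_ae (Eventually.of_forall fun t => ?_)
  by_cases ht : t ∈ Ioc a b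
  · simp only [indicator_of_mem ht, Circle.smul_def, Real.fourierChar_apply, smul_eq_mul]
    congr 3
    push_cast
    field_simp
  · simp [indicator_of_notMem ht]

theorem tendsto_intervalIntegral_mul_cos {f : ℝ → ℝ} {a b : ℝ} (hab : a ≤ b)
    (hf : IntervalIntegrable f volume a b) :
    Tendsto (fun w : ℝ => ∫ t in a..b, f t * Real.cos (w * t)) atTop (𝓝 0) := by
  have h := (Complex.continuous_re.tendsto _).comp
    (tendsto_intervalIntegral_mul_cexp (f := f) hab)
  simp only [Complex.zero_re] at h
  refine h.congr fun w => ?_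
  have hi : IntervalIntegrable (fun t => Complex.exp (↑(-(w * t)) * Complex.I) * (f t : ℂ))
      volume a b :=
    IntervalIntegrable.continuousOn_mul (f := fun t => (f t : ℂ)) ⟨hf.1.ofReal, hf.2.ofReal⟩
      (by fun_prop)
  have := Complex.reCLM.intervalIntegral_comp_comm hi
  simp only [Function.comp, Complex.reCLM_apply] at this ⊢
  rw [← this]
  refine integral_congr fun t _ => ?_
  simp only [Complex.re_mul_ofReal, Complex.exp_ofReal_mul_I_re, Real.cos_neg]
  exact mul_comm _ _

theorem tendsto_intervalIntegral_mul_sin {f : ℝ → ℝ} {a b : ℝ} (hab : a ≤ b)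
    (hf : IntervalIntegrable f volume a b) :
    Tendsto (fun w : ℝ => ∫ t in a..b, f t * Real.sin (w * t)) atTop (𝓝 0) := by
  have h := ((Complex.continuous_im.tendsto _).comp
    (tendsto_intervalIntegral_mul_cexp (f := f) hab)).neg
  simp only [Complex.zero_im, neg_zero] at h
  refine h.congr fun w => ?_
  have hi : IntervalIntegrable (fun t => Complex.exp (↑(-(w * t)) * Complex.I) * (f t : ℂ))
      volume a b :=
    IntervalIntegrable.continuousOn_mul (f := fun t => (f t : ℂ)) ⟨hf.1.ofReal, hf.2.ofReal⟩
      (by fun_prop)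
  have := Complex.imCLM.intervalIntegral_comp_comm hi
  simp only [Function.comp, Complex.imCLM_apply] at this ⊢
  rw [← this, ← intervalIntegral.integral_neg]
  refine integral_congr fun t _ => ?_
  simp only [Complex.im_mul_ofReal, Complex.exp_ofReal_mul_I_im, Real.sin_neg]
  ring

/-- The Dirichlet kernel of period `1`, namely `1 + 2 ∑_{n ≤ N} cos (2 π n u)`. -/
noncomputable def dirichletKernelOne (N : ℕ) (u : ℝ) : ℝ :=
  1 + 2 * ∑ n ∈ Finset.Icc 1 N, Real.cos (2 * (n : ℝ) * Real.pi * u)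

theorem sin_mul_dirichletKernelOne (N : ℕ) (u : ℝ) :
    Real.sin (Real.pi * u) * dirichletKernelOne N u =
      Real.sin ((2 * (N : ℝ) + 1) * Real.pi * u) := by
  induction N with
  | zero => simp [dirichletKernelOne]
  | succ N ih =>
    unfold dirichletKernelOne at ih ⊢
    rw [Finset.sum_Icc_succ_top (by omega)]
    have h1 : Real.sin ((2 * ((N + 1 : ℕ) : ℝ) + 1) * Real.pi * u) =
        Real.sin (2 * ((N + 1 : ℕ) : ℝ) * Real.pi * u + Real.pi * u) := by ring_nf
    have h2 : Real.sin ((2 * (N : ℝ) + 1) * Real.pi * u) =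
        Real.sin (2 * ((N + 1 : ℕ) : ℝ) * Real.pi * u - Real.pi * u) := by
      push_cast; ring_nf
    rw [h2, Real.sin_sub] at ih
    rw [h1, Real.sin_add]
    linear_combination ih

/-- A partial sum of the Fourier series of `f` is an integral against the Dirichlet kernel. -/
theorem fourierPartialSum_eq_integral_dirichletKernelOne {f : ℝ → ℝ}
    (hf : IntervalIntegrable f volume 0 1) (x : ℝ) (N : ℕ) :
    (∫ t in (0 : ℝ)..1, f t) + ∑ n ∈ Finset.Icc 1 N,
      (2 * (∫ t in (0 : ℝ)..1, f t * Real.cos (2 * (n : ℝ) * Real.pi * t)) *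
          Real.cos (2 * (n : ℝ) * Real.pi * x) +
        2 * (∫ t in (0 : ℝ)..1, f t * Real.sin (2 * (n : ℝ) * Real.pi * t)) *
          Real.sin (2 * (n : ℝ) * Real.pi * x)) =
      ∫ t in (0 : ℝ)..1, f t * dirichletKernelOne N (t - x) := by
  have hc : ∀ g : ℝ → ℝ, Continuous g → IntervalIntegrable (fun t => f t * g t) volume 0 1 :=
    fun g hg => hf.mul_continuousOn hg.continuousOn
  have hterm : ∀ n : ℕ,
      2 * (∫ t in (0 : ℝ)..1, f t * Real.cos (2 * (n : ℝ) * Real.pi * t)) *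
          Real.cos (2 * (n : ℝ) * Real.pi * x) +
        2 * (∫ t in (0 : ℝ)..1, f t * Real.sin (2 * (n : ℝ) * Real.pi * t)) *
          Real.sin (2 * (n : ℝ) * Real.pi * x) =
      ∫ t in (0 : ℝ)..1, f t * (2 * Real.cos (2 * (n : ℝ) * Real.pi * (t - x))) := by
    intro n
    rw [← intervalIntegral.integral_const_mul, ← intervalIntegral.integral_const_mul,
      ← intervalIntegral.integral_mul_const, ← intervalIntegral.integral_mul_const,
      ← intervalIntegral.integral_add
        (((hc (fun t => Real.cos (2 * (n : ℝ) * Real.pi * t))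
          (by fun_prop)).const_mul _).mul_const _)
        (((hc (fun t => Real.sin (2 * (n : ℝ) * Real.pi * t))
          (by fun_prop)).const_mul _).mul_const _)]
    refine integral_congr fun t _ => ?_
    simp only [mul_sub, Real.cos_sub]
    ring
  rw [Finset.sum_congr rfl fun n _ => hterm n, ← intervalIntegral.integral_finsetSum
    fun n _ => hc _ (by fun_prop), ← intervalIntegral.integral_add hf
    (by simpa only [Finset.mul_sum] using hc (fun t => ∑ n ∈ Finset.Icc 1 N,
      2 * Real.cos (2 * (n : ℝ) * Real.pi * (t - x))) (by fun_prop))]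
  refine integral_congr fun t _ => ?_
  simp only [dirichletKernelOne, mul_add, Finset.mul_sum, mul_one]

theorem continuous_dirichletKernelOne (N : ℕ) : Continuous (dirichletKernelOne N) := by
  unfold dirichletKernelOne
  fun_prop

theorem integral_cos_two_mul_nat_mul_pi {n : ℕ} (hn : n ≠ 0) :
    ∫ t in (0 : ℝ)..1, Real.cos (2 * (n : ℝ) * Real.pi * t) = 0 := by
  have h : 2 * (n : ℝ) * Real.pi ≠ 0 := by positivity
  rw [intervalIntegral.integral_comp_mul_left _ h, integral_cos]
  have : Real.sin (2 * n * Real.pi) = 0 := by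
    exact_mod_cast Real.sin_nat_mul_pi (2 * n)
  simp [this]

theorem integral_sin_two_mul_nat_mul_pi (n : ℕ) :
    ∫ t in (0 : ℝ)..1, Real.sin (2 * (n : ℝ) * Real.pi * t) = 0 := by
  rcases eq_or_ne n 0 with rfl | hn
  · simp
  have h : 2 * (n : ℝ) * Real.pi ≠ 0 := by positivity
  rw [intervalIntegral.integral_comp_mul_left _ h, integral_sin]
  have : Real.cos (2 * n * Real.pi) = 1 := by
    rw [← Real.cos_nat_mul_two_pi n]; ring_nf
  simp [this]

theorem integral_dirichletKernelOne (N : ℕ) (x : ℝ) :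
    ∫ t in (0 : ℝ)..1, dirichletKernelOne N (t - x) = 1 := by
  have h := fourierPartialSum_eq_integral_dirichletKernelOne (f := fun _ => 1)
    intervalIntegrable_const x N
  simp only [one_mul] at h
  rw [← h, Finset.sum_eq_zero]
  · simp
  · intro n hn
    rw [integral_cos_two_mul_nat_mul_pi (by have := (Finset.mem_Icc.1 hn).1; omega),
      integral_sin_two_mul_nat_mul_pi]
    simp

theorem sin_pi_mul_ne_zero_of_abs_lt_one {u : ℝ} (h0 : u ≠ 0) (h : |u| < 1) :
    Real.sin (Real.pi * u) ≠ 0 := by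
  obtain ⟨h1, h2⟩ := abs_lt.1 h
  have hpi := Real.pi_pos
  rcases lt_or_gt_of_ne h0 with hu | hu
  · exact (Real.sin_neg_of_neg_of_neg_pi_lt (by nlinarith) (by nlinarith)).ne
  · exact (Real.sin_pos_of_pos_of_lt_pi (by positivity) (by nlinarith)).ne'

/-- The Dini quotient is integrable: near `x` it is bounded because `f` is differentiable there,
and away from `x` the denominator is bounded below. -/
theorem intervalIntegrable_sub_div_sin {f : ℝ → ℝ} (hf : IntervalIntegrable f volume 0 1)
    {x : ℝ} (hx0 : 0 < x) (hx1 : x < 1) (hd : DifferentiableAt ℝ f x) :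
    IntervalIntegrable (fun t => (f t - f x) / Real.sin (Real.pi * (t - x))) volume 0 1 := by
  have hsl : IntervalIntegrable (fun t => (f t - f x) / (t - x)) volume 0 1 := by
    have hev : ∀ᶠ t in 𝓝 x, |dslope f x t| < |dslope f x x| + 1 :=
      (continuousAt_dslope_same.2 hd).abs.eventually_lt_const (by linarith)
    obtain ⟨δ, hδ, hb⟩ := Metric.eventually_nhds_iff.1 hev
    set C := |dslope f x x| + 1
    have hsub : IntervalIntegrable (fun t => f t - f x) volume 0 1 :=
      hf.sub intervalIntegrable_const
    refine ((intervalIntegrable_const (c := C)).add (hsub.abs.div_const δ)).mono_fun ?_ ?_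
    · exact (hsub.def'.aestronglyMeasurable.aemeasurable.div
        (by fun_prop)).aestronglyMeasurable
    · refine Eventually.of_forall fun t => ?_
      have hC : 0 < C := by positivity
      simp only [Real.norm_eq_abs]
      rw [abs_of_nonneg (a := C + _) (by positivity)]
      rcases eq_or_ne t x with rfl | htx
      · simpa using hC.le
      rcases lt_or_ge (dist t x) δ with h | h
      · have := hb h
        rw [dslope_of_ne _ htx, slope_def_field] at this
        have : 0 ≤ |f t - f x| / δ := by positivity
        linarith
      · rw [abs_div]
        have : |f t - f x| / |t - x| ≤ |f t - f x| / δ := by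
          gcongr
          exact h
        linarith
  have hq : ContinuousOn (fun t => (Real.pi * Real.sinc (Real.pi * (t - x)))⁻¹) (uIcc 0 1) := by
    refine ContinuousOn.inv₀ (by have := Real.continuous_sinc; fun_prop) fun t ht => ?_
    rw [uIcc_of_le zero_le_one] at ht
    refine mul_ne_zero Real.pi_ne_zero ?_
    rcases eq_or_ne t x with rfl | htx
    · simp
    · have h0 : t - x ≠ 0 := sub_ne_zero.2 htx
      rw [Real.sinc_of_ne_zero (by positivity)]
      exact div_ne_zero (sin_pi_mul_ne_zero_of_abs_lt_one h0
        (abs_lt.2 ⟨by linarith [ht.1], by linarith [ht.2]⟩)) (by positivity)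
  refine (hsl.mul_continuousOn hq).congr fun t _ => ?_
  rcases eq_or_ne t x with rfl | htx
  · simp
  · have h0 : t - x ≠ 0 := sub_ne_zero.2 htx
    rw [Real.sinc_of_ne_zero (by positivity)]
    field_simp

/-- **Dini's test**: the Fourier series of an integrable function on `[0, 1]` converges to the
function at every interior point of differentiability. -/
theorem tendsto_fourierPartialSum_of_differentiableAt {f : ℝ → ℝ}
    (hf : IntervalIntegrable f volume 0 1) {x : ℝ} (hx0 : 0 < x) (hx1 : x < 1)
    (hd : DifferentiableAt ℝ f x) :
    Tendsto (fun N : ℕ => (∫ t in (0 : ℝ)..1, f t) + ∑ n ∈ Finset.Icc 1 N,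
      (2 * (∫ t in (0 : ℝ)..1, f t * Real.cos (2 * (n : ℝ) * Real.pi * t)) *
          Real.cos (2 * (n : ℝ) * Real.pi * x) +
        2 * (∫ t in (0 : ℝ)..1, f t * Real.sin (2 * (n : ℝ) * Real.pi * t)) *
          Real.sin (2 * (n : ℝ) * Real.pi * x))) atTop (𝓝 (f x)) := by
  have hg := intervalIntegrable_sub_div_sin hf hx0 hx1 hd
  set g := fun t => (f t - f x) / Real.sin (Real.pi * (t - x)) with hgdef
  -- `g` absorbs the denominator of the Dirichlet kernel, whose numerator oscillates with
  -- frequency `w N`.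
  set w : ℕ → ℝ := fun N => (2 * (N : ℝ) + 1) * Real.pi with hw
  have hwt : Tendsto w atTop atTop :=
    (tendsto_atTop_add_const_right _ _
      (tendsto_natCast_atTop_atTop.const_mul_atTop two_pos)).atTop_mul_const Real.pi_pos
  have key : ∀ N : ℕ, (∫ t in (0 : ℝ)..1, f t * dirichletKernelOne N (t - x)) =
      f x + ((∫ t in (0 : ℝ)..1, g t * Real.sin (w N * t)) * Real.cos (w N * x) -
        (∫ t in (0 : ℝ)..1, g t * Real.cos (w N * t)) * Real.sin (w N * x)) := by
    intro N
    have hK : Continuous fun t => dirichletKernelOne N (t - x) :=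
      (continuous_dirichletKernelOne N).comp (by fun_prop)
    have h1 : f x = ∫ t in (0 : ℝ)..1, f x * dirichletKernelOne N (t - x) := by
      rw [intervalIntegral.integral_const_mul, integral_dirichletKernelOne, mul_one]
    rw [← sub_eq_iff_eq_add']
    refine (congrArg _ h1).trans ?_
    rw [← intervalIntegral.integral_sub (hf.mul_continuousOn hK.continuousOn)
        ((hK.intervalIntegrable _ _).const_mul _), ← intervalIntegral.integral_mul_const,
      ← intervalIntegral.integral_mul_const, ← intervalIntegral.integral_sub
        ((hg.mul_continuousOn (by fun_prop)).mul_const _)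
        ((hg.mul_continuousOn (by fun_prop)).mul_const _)]
    refine integral_congr fun t ht => ?_
    rw [uIcc_of_le zero_le_one] at ht
    have h2 : g t * Real.sin (w N * (t - x)) =
        f t * dirichletKernelOne N (t - x) - f x * dirichletKernelOne N (t - x) := by
      rw [← sin_mul_dirichletKernelOne, hgdef]
      rcases eq_or_ne t x with rfl | htx
      -- At `t = x` both sides vanish because of the factor `f t - f x`.
      · simp
      · have := sin_pi_mul_ne_zero_of_abs_lt_one (sub_ne_zero.2 htx)
          (abs_lt.2 ⟨by linarith [ht.1], by linarith [ht.2]⟩)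
        field_simp
    rw [← h2, mul_sub, Real.sin_sub]
    ring
  have hbdd : ∀ u v : ℕ → ℝ, Tendsto u atTop (𝓝 0) → (∀ N, |v N| ≤ 1) →
      Tendsto (fun N => u N * v N) atTop (𝓝 0) := fun u v hu hv =>
    squeeze_zero_norm (a := fun N => |u N|) (fun N => by
      rw [norm_mul]
      exact mul_le_of_le_one_right (abs_nonneg _) (hv N)) (by simpa using hu.abs)
  have hs := hbdd _ _ ((tendsto_intervalIntegral_mul_sin zero_le_one hg).comp hwt)
    fun N => Real.abs_cos_le_one (w N * x)
  have hc := hbdd _ _ ((tendsto_intervalIntegral_mul_cos zero_le_one hg).comp hwt)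
    fun N => Real.abs_sin_le_one (w N * x)
  have := (hs.sub hc).const_add (f x)
  simp only [sub_zero, add_zero] at this
  refine this.congr fun N => ?_
  rw [fourierPartialSum_eq_integral_dirichletKernelOne hf, key]
  rfl

/-! ### The cosine integral near infinity and near zero -/

/-- The entire cosine integral `Cin T = ∫_0^T (1 - cos t) / t dt`. -/
noncomputable def cosIntegralEntire (T : ℝ) : ℝ :=
  ∫ t in (0 : ℝ)..T, (1 - Real.cos t) / t

/-- Through `sinc`, the integrand of `Cin` is seen to be continuous at `0`, where the junk value
`0 / 0 = 0` happens to be the limit. -/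
theorem one_sub_cos_div_eq (t : ℝ) :
    (1 - Real.cos t) / t = Real.sin (t / 2) * Real.sinc (t / 2) := by
  rcases eq_or_ne t 0 with rfl | ht
  · simp
  · have h : Real.cos t = 1 - 2 * Real.sin (t / 2) ^ 2 := by
      rw [Real.sin_sq, show t = 2 * (t / 2) by ring, Real.cos_two_mul]
      ring_nf
    rw [Real.sinc_of_ne_zero (by positivity), h]
    field_simp
    ring

theorem continuous_one_sub_cos_div : Continuous fun t : ℝ => (1 - Real.cos t) / t := by
  simp only [one_sub_cos_div_eq]
  have := Real.continuous_sinc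
  fun_prop

theorem continuous_cosIntegralEntire : Continuous cosIntegralEntire :=
  intervalIntegral.continuous_primitive
    (fun _ _ => continuous_one_sub_cos_div.intervalIntegrable _ _) 0

theorem integral_one_sub_cos_mul_div {a : ℝ} (ha : a ≠ 0) (b : ℝ) :
    ∫ t in (0 : ℝ)..b, (1 - Real.cos (a * t)) / t = cosIntegralEntire (a * b) := by
  have h := intervalIntegral.mul_integral_comp_mul_left (a := 0) (b := b)
    (f := fun t => (1 - Real.cos t) / t) a
  rw [mul_zero] at h
  rw [cosIntegralEntire, ← h, ← intervalIntegral.integral_const_mul]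
  refine integral_congr fun t _ => ?_
  rcases eq_or_ne t 0 with rfl | ht
  · simp
  · field_simp

theorem intervalIntegrable_cos_div {y T : ℝ} (hy : 0 < y) (hT : 0 < T) :
    IntervalIntegrable (fun t => Real.cos t / t) volume y T :=
  (ContinuousOn.div (by fun_prop) (by fun_prop) fun _ ht =>
    ((lt_min hy hT).trans_le ht.1).ne').intervalIntegrable

theorem integral_cos_div {y T : ℝ} (hy : 0 < y) (hT : 0 < T) :
    ∫ t in y..T, Real.cos t / t =
      (cosIntegralEntire y - Real.log y) - (cosIntegralEntire T - Real.log T) := by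
  have h0 : (0 : ℝ) ∉ uIcc y T := fun h => ((lt_min hy hT).trans_le h.1).ne' rfl
  have h1 : cosIntegralEntire T - cosIntegralEntire y = ∫ t in y..T, (1 - Real.cos t) / t :=
    integral_interval_sub_left (continuous_one_sub_cos_div.intervalIntegrable _ _)
      (continuous_one_sub_cos_div.intervalIntegrable _ _)
  have h2 : ∫ t in y..T, (1 - Real.cos t) / t =
      (∫ t in y..T, t⁻¹) - ∫ t in y..T, Real.cos t / t := by
    rw [← intervalIntegral.integral_sub _ (intervalIntegrable_cos_div hy hT)]
    · exact integral_congr fun t _ => by ring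
    · exact intervalIntegrable_inv (fun t ht h => h0 (h ▸ ht)) continuousOn_id
  rw [integral_inv_of_pos hy hT, Real.log_div hT.ne' hy.ne'] at h2
  linarith

theorem one_sub_cos_div_sin_eq_sum (n : ℕ) {u : ℝ} (hu0 : 0 ≤ u) (hu : u ≤ Real.pi / 2) :
    (1 - Real.cos (2 * (n : ℝ) * u)) / Real.sin u =
      ∑ k ∈ Finset.range n, 2 * Real.sin ((2 * (k : ℝ) + 1) * u) := by
  rcases hu0.eq_or_lt with rfl | hu0
  · simp
  have hs : Real.sin u ≠ 0 :=
    (Real.sin_pos_of_pos_of_lt_pi hu0 (by linarith [Real.pi_pos])).ne'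
  induction n with
  | zero => simp
  | succ n ih =>
    rw [Finset.sum_range_succ, ← ih, div_eq_iff hs, add_mul, div_mul_cancel₀ _ hs]
    have h1 : 2 * ((n + 1 : ℕ) : ℝ) * u = (2 * (n : ℝ) + 1) * u + u := by push_cast; ring
    have h2 : 2 * (n : ℝ) * u = (2 * (n : ℝ) + 1) * u - u := by ring
    rw [h1, h2, Real.cos_add, Real.cos_sub]
    ring

theorem sum_range_two_div_odd (n : ℕ) :
    ∑ k ∈ Finset.range n, 2 / (2 * (k : ℝ) + 1) = 2 * (harmonic (2 * n) : ℝ) - harmonic n := by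
  induction n with
  | zero => simp
  | succ n ih =>
    rw [Finset.sum_range_succ, ih, show 2 * (n + 1) = 2 * n + 1 + 1 by ring, harmonic_succ,
      harmonic_succ, harmonic_succ]
    push_cast
    field_simp
    ring

theorem integral_one_sub_cos_div_sin (n : ℕ) :
    ∫ u in (0 : ℝ)..(Real.pi / 2), (1 - Real.cos (2 * (n : ℝ) * u)) / Real.sin u =
      2 * (harmonic (2 * n) : ℝ) - harmonic n := by
  have hpi := Real.pi_pos
  rw [← sum_range_two_div_odd, integral_congr (g := fun u =>
    ∑ k ∈ Finset.range n, 2 * Real.sin ((2 * (k : ℝ) + 1) * u))]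
  · rw [intervalIntegral.integral_finsetSum fun k _ =>
      (by fun_prop : Continuous fun u : ℝ => _).intervalIntegrable _ _]
    refine Finset.sum_congr rfl fun k _ => ?_
    have hk : 2 * (k : ℝ) + 1 ≠ 0 := by positivity
    have hcos : Real.cos ((2 * (k : ℝ) + 1) * (Real.pi / 2)) = 0 :=
      Real.cos_eq_zero_iff.2 ⟨k, by push_cast; ring⟩
    rw [intervalIntegral.integral_const_mul, intervalIntegral.integral_comp_mul_left _ hk,
      integral_sin, hcos]
    simp
    rfl
  · intro u hu
    rw [uIcc_of_le (by positivity)] at hu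
    exact one_sub_cos_div_sin_eq_sum n hu.1 hu.2

/-- A primitive of `1 / u - 1 / sin u` on `(0, π / 2)` is `log (u / tan (u / 2))`, which written
through `sinc` is continuous at `0`. As the derivative is negative, its integrability is
automatic. -/
theorem intervalIntegrable_and_integral_inv_sub_inv_sin :
    IntervalIntegrable (fun u => u⁻¹ - (Real.sin u)⁻¹) volume 0 (Real.pi / 2) ∧
      ∫ u in (0 : ℝ)..(Real.pi / 2), (u⁻¹ - (Real.sin u)⁻¹) =
        Real.log Real.pi - 2 * Real.log 2 := by
  have hpi := Real.pi_pos
  have hle : (0 : ℝ) ≤ Real.pi / 2 := by positivity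
  set h : ℝ → ℝ := fun u =>
    Real.log (2 * Real.cos (u / 2)) - Real.log (Real.sinc (u / 2)) with hh
  have hcospos : ∀ u ∈ Icc 0 (Real.pi / 2), 0 < Real.cos (u / 2) := fun u hu =>
    Real.cos_pos_of_mem_Ioo ⟨by linarith [hu.1], by linarith [hu.2]⟩
  have hsinpos : ∀ u ∈ Icc 0 (Real.pi / 2), 0 < u → 0 < Real.sin (u / 2) := fun u hu h0 =>
    Real.sin_pos_of_pos_of_lt_pi (by linarith) (by linarith [hu.2])
  have hcont : ContinuousOn h (Icc 0 (Real.pi / 2)) := by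
    have := Real.continuous_sinc
    refine ContinuousOn.sub (ContinuousOn.log (by fun_prop) fun u hu => ?_)
      (ContinuousOn.log (by fun_prop) fun u hu => ?_)
    · exact (mul_pos two_pos (hcospos u hu)).ne'
    · rcases hu.1.eq_or_lt with rfl | h0
      · simp
      · rw [Real.sinc_of_ne_zero (by positivity)]
        exact (div_pos (hsinpos u hu h0) (by positivity)).ne'
  have hderiv : ∀ u ∈ Ioo 0 (Real.pi / 2), HasDerivAt h (u⁻¹ - (Real.sin u)⁻¹) u := by
    intro u hu
    have hc := hcospos u (Ioo_subset_Icc_self hu)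
    have hs := hsinpos u (Ioo_subset_Icc_self hu) hu.1
    have h0 : u ≠ 0 := hu.1.ne'
    have hd : HasDerivAt (fun u => u / 2) (1 / 2 : ℝ) u := (hasDerivAt_id u).div_const 2
    have h1 : HasDerivAt (fun u => Real.log (2 * Real.cos (u / 2)) -
        (Real.log (Real.sin (u / 2)) - Real.log (u / 2))) (u⁻¹ - (Real.sin u)⁻¹) u := by
      refine (((hd.cos.const_mul 2).log (by positivity)).sub
        ((hd.sin.log hs.ne').sub (hd.log (by positivity)))).congr_deriv ?_
      have : Real.sin u = 2 * Real.sin (u / 2) * Real.cos (u / 2) := by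
        rw [← Real.sin_two_mul]; ring_nf
      rw [this]
      field_simp
      linear_combination -u * Real.sin_sq_add_cos_sq (u / 2)
    refine h1.congr_of_eventuallyEq ?_
    filter_upwards [Ioo_mem_nhds hu.1 hu.2] with v hv
    have hv0 : v ≠ 0 := hv.1.ne'
    rw [hh]
    simp only
    rw [Real.sinc_of_ne_zero (by positivity),
      Real.log_div (hsinpos v (Ioo_subset_Icc_self hv) hv.1).ne' (by positivity)]
  have hint : IntervalIntegrable (fun u => u⁻¹ - (Real.sin u)⁻¹) volume 0 (Real.pi / 2) := by
    have := intervalIntegrable_deriv_of_nonneg (a := 0) (b := Real.pi / 2)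
      (g := fun u => -h u) (g' := fun u => -(u⁻¹ - (Real.sin u)⁻¹))
    simp only [uIcc_of_le hle, min_eq_left hle, max_eq_right hle] at this
    have h2 := (this hcont.neg (fun u hu => (hderiv u hu).neg) fun u hu => ?_).neg
    · exact h2.congr fun u _ => by simp
    · rw [neg_sub, sub_nonneg]
      exact inv_anti₀ (Real.sin_pos_of_pos_of_lt_pi hu.1 (by linarith [hu.2]))
        (Real.sin_lt hu.1).le
  refine ⟨hint, ?_⟩
  rw [integral_eq_sub_of_hasDerivAt_of_le hle hcont hderiv hint, hh]
  simp only
  rw [Real.sinc_of_ne_zero (by positivity), show Real.pi / 2 / 2 = Real.pi / 4 by ring,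
    Real.cos_pi_div_four, Real.sin_pi_div_four]
  have h2 : 2 * (√2 / 2) = √2 := by ring
  have h4 : Real.log 4 = 2 * Real.log 2 := by
    rw [show (4 : ℝ) = 2 ^ 2 by norm_num, Real.log_pow]; norm_num
  rw [h2, Real.log_div (by positivity) (by positivity), Real.log_div (by positivity) two_ne_zero,
    Real.log_div hpi.ne' (by norm_num), h4]
  simp
  ring

/-- By scaling, `Cin (n π) = ∫_0^{π/2} (1 - cos 2nu) / u du`. Replacing `1 / u` by `1 / sin u` turns
this into the harmonic expression `2 H_{2n} - H_n`; the cost is the integral of the fixed integrable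
function `1 / u - 1 / sin u`, up to a term that vanishes by the Riemann–Lebesgue lemma. -/
theorem tendsto_cosIntegralEntire_nat_mul_pi :
    Tendsto (fun n : ℕ => cosIntegralEntire ((n : ℝ) * Real.pi) - Real.log ((n : ℝ) * Real.pi))
      atTop (𝓝 Real.eulerMascheroniConstant) := by
  have hpi := Real.pi_pos
  obtain ⟨hint, hval⟩ := intervalIntegrable_and_integral_inv_sub_inv_sin
  have hw : Tendsto (fun n : ℕ => 2 * (n : ℝ)) atTop atTop :=
    tendsto_natCast_atTop_atTop.const_mul_atTop two_pos
  have hRL := (tendsto_intervalIntegral_mul_cos (by positivity) hint).comp hw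
  have hH := Real.tendsto_harmonic_sub_log
  have hH2 := hH.comp (tendsto_id.const_mul_atTop' (two_pos : 0 < 2) :
    Tendsto (fun n : ℕ => 2 * n) atTop atTop)
  have key : ∀ n : ℕ, n ≠ 0 → cosIntegralEntire ((n : ℝ) * Real.pi) =
      Real.log Real.pi - 2 * Real.log 2 -
        (∫ u in (0 : ℝ)..(Real.pi / 2), (u⁻¹ - (Real.sin u)⁻¹) * Real.cos (2 * (n : ℝ) * u)) +
        (2 * (harmonic (2 * n) : ℝ) - harmonic n) := by
    intro n hn
    have hn' : 2 * (n : ℝ) ≠ 0 := by positivity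
    have hsin : IntervalIntegrable
        (fun u => (1 - Real.cos (2 * (n : ℝ) * u)) / Real.sin u) volume 0 (Real.pi / 2) := by
      refine IntervalIntegrable.congr (f := fun u =>
        ∑ k ∈ Finset.range n, 2 * Real.sin ((2 * (k : ℝ) + 1) * u)) (fun u hu => ?_)
        ((by fun_prop : Continuous _).intervalIntegrable _ _)
      rw [uIoc_of_le (by positivity)] at hu
      exact (one_sub_cos_div_sin_eq_sum n hu.1.le hu.2).symm
    rw [← hval, ← integral_one_sub_cos_div_sin, ← intervalIntegral.integral_sub hint
      (hint.mul_continuousOn (by fun_prop)), ← intervalIntegral.integral_add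
      (hint.sub (hint.mul_continuousOn (by fun_prop))) hsin,
      show (n : ℝ) * Real.pi = 2 * (n : ℝ) * (Real.pi / 2) by ring,
      ← integral_one_sub_cos_mul_div hn']
    refine integral_congr fun u _ => ?_
    ring
  have hlim := ((hH2.const_mul 2).sub hH).sub hRL
  rw [show 2 * Real.eulerMascheroniConstant - Real.eulerMascheroniConstant - 0 =
    Real.eulerMascheroniConstant by ring] at hlim
  refine hlim.congr' ?_
  filter_upwards [eventually_ne_atTop 0] with n hn
  have hn' : (n : ℝ) ≠ 0 := by positivity
  rw [key n hn, Real.log_mul hn' hpi.ne']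
  simp only [Function.comp]
  push_cast
  rw [Real.log_mul two_ne_zero hn']
  ring

/-- Between consecutive multiples of `π` the function `Cin T - log T` varies by at most
`1 / n`, so its limit along `n π` is its limit at infinity. -/
theorem tendsto_cosIntegralEntire_sub_log :
    Tendsto (fun T => cosIntegralEntire T - Real.log T) atTop
      (𝓝 Real.eulerMascheroniConstant) := by
  have hpi := Real.pi_pos
  have hfl : Tendsto (fun T : ℝ => ⌊T / Real.pi⌋₊) atTop atTop :=
    tendsto_nat_floor_atTop.comp (tendsto_id.atTop_div_const hpi)
  have h1 := tendsto_cosIntegralEntire_nat_mul_pi.comp hfl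
  have h2 : Tendsto (fun T : ℝ => ∫ t in ((⌊T / Real.pi⌋₊ : ℝ) * Real.pi)..T,
      Real.cos t / t) atTop (𝓝 0) := by
    refine squeeze_zero_norm' ?_ (tendsto_one_div_atTop_nhds_zero_nat.comp hfl)
    filter_upwards [eventually_ge_atTop Real.pi] with T hT
    have hn1 : 1 ≤ ⌊T / Real.pi⌋₊ := (Nat.one_le_floor_iff _).2 ((one_le_div hpi).2 hT)
    set n := ⌊T / Real.pi⌋₊
    have hn : (0 : ℝ) < n := by exact_mod_cast hn1
    have hle : (n : ℝ) * Real.pi ≤ T :=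
      (le_div_iff₀ hpi).1 (Nat.floor_le (div_nonneg (hpi.le.trans hT) hpi.le))
    have hlt : T < ((n : ℝ) + 1) * Real.pi := (div_lt_iff₀ hpi).1 (Nat.lt_floor_add_one _)
    have := norm_integral_le_of_norm_le_const (a := (n : ℝ) * Real.pi) (b := T)
      (f := fun t => Real.cos t / t) (C := 1 / ((n : ℝ) * Real.pi)) fun t ht => by
        rw [uIoc_of_le hle] at ht
        have ht0 : 0 < t := lt_trans (by positivity) ht.1
        rw [norm_div, Real.norm_eq_abs, Real.norm_eq_abs, abs_of_pos ht0]
        exact div_le_div₀ zero_le_one (Real.abs_cos_le_one _) (by positivity) ht.1.le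
    refine this.trans ?_
    rw [abs_of_nonneg (by linarith)]
    calc 1 / ((n : ℝ) * Real.pi) * (T - n * Real.pi) ≤ 1 / ((n : ℝ) * Real.pi) * Real.pi := by
          gcongr; linarith
      _ = 1 / (n : ℝ) := by field_simp
  have h3 := h1.sub h2
  rw [sub_zero] at h3
  refine h3.congr' ?_
  filter_upwards [eventually_ge_atTop Real.pi] with T hT
  have hn1 : 1 ≤ ⌊T / Real.pi⌋₊ := (Nat.one_le_floor_iff _).2 ((one_le_div hpi).2 hT)
  have hn : (0 : ℝ) < ⌊T / Real.pi⌋₊ := by exact_mod_cast hn1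
  rw [integral_cos_div (by positivity) (hpi.trans_le hT)]
  simp only [Function.comp]
  ring

theorem tendsto_neg_integral_cos_div {y : ℝ} (hy : 0 < y) :
    Tendsto (fun T : ℝ => -∫ t in y..T, Real.cos t / t) atTop
      (𝓝 (Real.eulerMascheroniConstant + Real.log y - cosIntegralEntire y)) := by
  have h := tendsto_cosIntegralEntire_sub_log.sub_const (cosIntegralEntire y - Real.log y)
  rw [show Real.eulerMascheroniConstant - (cosIntegralEntire y - Real.log y) =
    Real.eulerMascheroniConstant + Real.log y - cosIntegralEntire y by ring] at h
  refine h.congr' ?_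
  filter_upwards [eventually_gt_atTop 0] with T hT
  rw [integral_cos_div hy hT]
  ring

theorem cosIntegral_eq {y : ℝ} (hy : 0 < y) :
    cosIntegral y = Real.eulerMascheroniConstant + Real.log y - cosIntegralEntire y := by
  have h := (tendsto_neg_integral_cos_div hy).neg
  simp only [neg_neg] at h
  rw [cosIntegral, h.limUnder_eq, neg_neg]

theorem tendsto_cos_mul_cosIntegral_sub_log :
    Tendsto (fun y : ℝ => Real.cos y * cosIntegral y - Real.log y) (𝓝[>] 0)
      (𝓝 Real.eulerMascheroniConstant) := by
  -- `(1 - cos y) log y = ((1 - cos y) / y) (y log y)` is continuous at `0`.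
  have hc : Continuous fun y => Real.cos y * (Real.eulerMascheroniConstant - cosIntegralEntire y) -
      (1 - Real.cos y) / y * (y * Real.log y) :=
    (Real.continuous_cos.mul (continuous_const.sub continuous_cosIntegralEntire)).sub
      (continuous_one_sub_cos_div.mul Real.continuous_mul_log)
  have h := (hc.tendsto 0).mono_left (nhdsWithin_le_nhds (s := Ioi 0))
  simp only [Real.cos_zero, cosIntegralEntire, integral_same, sub_zero, one_mul, sub_self,
    zero_div, zero_mul] at h
  refine h.congr' ?_
  filter_upwards [self_mem_nhdsWithin] with y hy
  have hy' : (0 : ℝ) < y := hy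
  rw [cosIntegral_eq hy', ← cosIntegralEntire]
  field_simp
  ring

/-! ### Mean and cosine coefficients of `log Γ` -/

theorem differentiableAt_log_Gamma {x : ℝ} (hx : 0 < x) :
    DifferentiableAt ℝ (fun x => Real.log (Real.Gamma x)) x :=
  (Real.differentiableAt_Gamma fun m =>
    ((neg_nonpos.2 m.cast_nonneg).trans_lt hx).ne').log (Real.Gamma_pos_of_pos hx).ne'

theorem continuousOn_log_Gamma : ContinuousOn (fun x => Real.log (Real.Gamma x)) (Ioi 0) :=
  fun _ hx => (differentiableAt_log_Gamma hx).continuousAt.continuousWithinAt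

/-- Near `0` the only singularity of `log Γ x = log Γ (x + 1) - log x` is logarithmic. -/
theorem intervalIntegrable_log_Gamma :
    IntervalIntegrable (fun x => Real.log (Real.Gamma x)) volume 0 1 := by
  have h1 : IntervalIntegrable (fun x => Real.log (Real.Gamma (x + 1))) volume 0 1 := by
    refine (continuousOn_log_Gamma.comp (by fun_prop) fun x hx => ?_).intervalIntegrable
    rw [uIcc_of_le zero_le_one] at hx
    exact add_pos_of_nonneg_of_pos hx.1 one_pos
  refine (h1.sub intervalIntegrable_log').congr fun x hx => ?_
  rw [uIoc_of_le zero_le_one] at hx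
  rw [Real.Gamma_add_one hx.1.ne', Real.log_mul hx.1.ne' (Real.Gamma_pos_of_pos hx.1).ne',
    add_sub_cancel_left]

theorem log_Gamma_add_log_Gamma_one_sub {t : ℝ} (h0 : 0 < t) (h1 : t < 1) :
    Real.log (Real.Gamma t) + Real.log (Real.Gamma (1 - t)) =
      Real.log Real.pi - Real.log (Real.sin (Real.pi * t)) := by
  have hpi := Real.pi_pos
  rw [← Real.log_mul (Real.Gamma_pos_of_pos h0).ne' (Real.Gamma_pos_of_pos (by linarith)).ne',
    Real.Gamma_mul_Gamma_one_sub, Real.log_div hpi.ne'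
    (Real.sin_pos_of_pos_of_lt_pi (by positivity) (by nlinarith)).ne']

theorem intervalIntegrable_log_sin_pi_mul :
    IntervalIntegrable (fun t => Real.log (Real.sin (Real.pi * t))) volume 0 1 := by
  have h := (intervalIntegrable_log_sin (a := 0) (b := Real.pi)).comp_mul_left
    (c := Real.pi)
  simpa [Function.comp_def, Real.pi_ne_zero] using h

/-- The reflection formula reduces integrals of `log Γ` against functions symmetric about `1 / 2`
to integrals of `log sin`. -/
theorem two_mul_integral_log_Gamma_mul_of_symm {φ : ℝ → ℝ} (hφ : Continuous φ)
    (hsymm : ∀ t, φ (1 - t) = φ t) :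
    2 * ∫ t in (0 : ℝ)..1, Real.log (Real.Gamma t) * φ t =
      Real.log Real.pi * (∫ t in (0 : ℝ)..1, φ t) -
        ∫ t in (0 : ℝ)..1, Real.log (Real.sin (Real.pi * t)) * φ t := by
  have hG : IntervalIntegrable (fun t => Real.log (Real.Gamma t) * φ t) volume 0 1 :=
    intervalIntegrable_log_Gamma.mul_continuousOn hφ.continuousOn
  have hG' : IntervalIntegrable (fun t => Real.log (Real.Gamma (1 - t)) * φ (1 - t))
      volume 0 1 := by
    simpa using (hG.comp_sub_left 1).symm
  have hrefl : ∫ t in (0 : ℝ)..1, Real.log (Real.Gamma (1 - t)) * φ (1 - t) =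
      ∫ t in (0 : ℝ)..1, Real.log (Real.Gamma t) * φ t := by
    rw [intervalIntegral.integral_comp_sub_left
      (fun t => Real.log (Real.Gamma t) * φ t) 1]
    simp
  rw [two_mul, ← intervalIntegral.integral_const_mul, ← intervalIntegral.integral_sub
    ((hφ.intervalIntegrable _ _).const_mul _)
    (intervalIntegrable_log_sin_pi_mul.mul_continuousOn hφ.continuousOn)]
  nth_rw 2 [← hrefl]
  rw [← intervalIntegral.integral_add hG hG']
  refine integral_congr_ae ?_
  -- The reflection formula fails at `t = 1`, where `Γ (1 - t) = Γ 0` is a junk value.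
  have hne : ∀ᵐ t : ℝ, t ≠ 1 := by simp [ae_iff]
  filter_upwards [hne] with t ht1 ht
  rw [uIoc_of_le zero_le_one] at ht
  rw [hsymm, ← add_mul, log_Gamma_add_log_Gamma_one_sub ht.1 (lt_of_le_of_ne ht.2 ht1), sub_mul]

theorem integral_log_sin_pi_mul :
    ∫ t in (0 : ℝ)..1, Real.log (Real.sin (Real.pi * t)) = -Real.log 2 := by
  rw [intervalIntegral.integral_comp_mul_left (fun t => Real.log (Real.sin t)) Real.pi_ne_zero,
    mul_zero, mul_one, integral_log_sin_zero_pi, smul_eq_mul]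
  field_simp

theorem integral_log_Gamma :
    ∫ t in (0 : ℝ)..1, Real.log (Real.Gamma t) = 1 / 2 * Real.log (2 * Real.pi) := by
  have h := two_mul_integral_log_Gamma_mul_of_symm (φ := fun _ => 1) continuous_const
    fun _ => rfl
  simp only [mul_one] at h
  rw [integral_log_sin_pi_mul] at h
  simp only [intervalIntegral.integral_const, sub_zero, one_smul, mul_one] at h
  rw [Real.log_mul two_ne_zero Real.pi_ne_zero]
  linarith

theorem sin_pi_mul_mul_sum_cos_odd (n : ℕ) (t : ℝ) :
    Real.sin (Real.pi * t) *
        ∑ k ∈ Finset.range n, 2 * Real.cos ((2 * (k : ℝ) + 1) * Real.pi * t) =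
      Real.sin (2 * (n : ℝ) * Real.pi * t) := by
  induction n with
  | zero => simp
  | succ n ih =>
    rw [Finset.sum_range_succ, mul_add, ih]
    have h1 : 2 * ((n + 1 : ℕ) : ℝ) * Real.pi * t =
        (2 * (n : ℝ) + 1) * Real.pi * t + Real.pi * t := by push_cast; ring
    have h2 : 2 * (n : ℝ) * Real.pi * t =
        (2 * (n : ℝ) + 1) * Real.pi * t - Real.pi * t := by ring
    rw [h1, h2, Real.sin_add, Real.sin_sub]
    ring

theorem integral_sum_cos_odd_mul_cos {n : ℕ} (hn : n ≠ 0) :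
    ∫ t in (0 : ℝ)..1, (∑ k ∈ Finset.range n,
      2 * Real.cos ((2 * (k : ℝ) + 1) * Real.pi * t)) * Real.cos (Real.pi * t) = 1 := by
  have hterm : ∀ k : ℕ, ∫ t in (0 : ℝ)..1,
      2 * Real.cos ((2 * (k : ℝ) + 1) * Real.pi * t) * Real.cos (Real.pi * t) =
      if k = 0 then 1 else 0 := by
    intro k
    have h : ∀ t : ℝ, 2 * Real.cos ((2 * (k : ℝ) + 1) * Real.pi * t) * Real.cos (Real.pi * t) =
        Real.cos (2 * ((k + 1 : ℕ) : ℝ) * Real.pi * t) + Real.cos (2 * (k : ℝ) * Real.pi * t) := by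
      intro t
      have h1 : 2 * ((k + 1 : ℕ) : ℝ) * Real.pi * t =
          (2 * (k : ℝ) + 1) * Real.pi * t + Real.pi * t := by push_cast; ring
      have h2 : 2 * (k : ℝ) * Real.pi * t =
          (2 * (k : ℝ) + 1) * Real.pi * t - Real.pi * t := by ring
      rw [h1, h2, Real.cos_add, Real.cos_sub]
      ring
    simp only [h]
    rw [intervalIntegral.integral_add
      ((by fun_prop : Continuous fun t : ℝ => _).intervalIntegrable _ _)
      ((by fun_prop : Continuous fun t : ℝ => _).intervalIntegrable _ _),
      integral_cos_two_mul_nat_mul_pi k.succ_ne_zero, zero_add]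
    split_ifs with hk
    · simp [hk]
    · exact integral_cos_two_mul_nat_mul_pi hk
  simp only [Finset.sum_mul]
  rw [intervalIntegral.integral_finsetSum fun k _ =>
      (by fun_prop : Continuous fun t : ℝ => _).intervalIntegrable _ _,
    Finset.sum_congr rfl fun k _ => hterm k]
  simp [Nat.pos_of_ne_zero hn]

/-- Integration by parts: the boundary term `log (sin π t) sin (2 n π t)` vanishes continuously at
both ends, since `sin (2 n π t)` is a multiple of `sin (π t)`. -/
theorem integral_log_sin_pi_mul_mul_cos {n : ℕ} (hn : n ≠ 0) :
    ∫ t in (0 : ℝ)..1, Real.log (Real.sin (Real.pi * t)) *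
      Real.cos (2 * (n : ℝ) * Real.pi * t) = -(1 / (2 * (n : ℝ))) := by
  have hpi := Real.pi_pos
  have hn' : (n : ℝ) ≠ 0 := by positivity
  set P : ℝ → ℝ := fun t =>
    ∑ k ∈ Finset.range n, 2 * Real.cos ((2 * (k : ℝ) + 1) * Real.pi * t) with hP
  have hPc : Continuous P := by fun_prop
  have hsP : ∀ t, Real.sin (2 * (n : ℝ) * Real.pi * t) = Real.sin (Real.pi * t) * P t :=
    fun t => (sin_pi_mul_mul_sum_cos_odd n t).symm
  set G : ℝ → ℝ := fun t => Real.log (Real.sin (Real.pi * t)) *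
    (Real.sin (2 * (n : ℝ) * Real.pi * t) / (2 * (n : ℝ) * Real.pi)) with hG
  have hGc : Continuous G := by
    have h : Continuous fun t => Real.sin (Real.pi * t) * Real.log (Real.sin (Real.pi * t)) *
        (P t / (2 * (n : ℝ) * Real.pi)) :=
      (Real.continuous_mul_log.comp
        (by fun_prop : Continuous fun t => Real.sin (Real.pi * t))).mul (hPc.div_const _)
    refine h.congr fun t => ?_
    simp only [hG, hsP]
    ring
  have hint1 : IntervalIntegrable (fun t => Real.log (Real.sin (Real.pi * t)) *
      Real.cos (2 * (n : ℝ) * Real.pi * t)) volume 0 1 :=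
    intervalIntegrable_log_sin_pi_mul.mul_continuousOn (by fun_prop)
  have hint2 : IntervalIntegrable (fun t => 1 / (2 * (n : ℝ)) * (P t * Real.cos (Real.pi * t)))
      volume 0 1 := (by fun_prop : Continuous _).intervalIntegrable _ _
  have hFTC := integral_eq_sub_of_hasDerivAt_of_le zero_le_one hGc.continuousOn
    (fun t ht => ?_) (hint1.add hint2)
  · rw [intervalIntegral.integral_add hint1 hint2, intervalIntegral.integral_const_mul,
      integral_sum_cos_odd_mul_cos hn] at hFTC
    have h0 : G 0 = 0 := by simp [hG]
    have h1 : G 1 = 0 := by simp [hG]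
    rw [h0, h1] at hFTC
    linarith
  · have hs : Real.sin (Real.pi * t) ≠ 0 :=
      (Real.sin_pos_of_pos_of_lt_pi (mul_pos hpi ht.1) (by nlinarith [ht.2])).ne'
    have hd1 : HasDerivAt (fun t => Real.pi * t) Real.pi t := by
      simpa using (hasDerivAt_id t).const_mul Real.pi
    have hd2 : HasDerivAt (fun t => 2 * (n : ℝ) * Real.pi * t) (2 * (n : ℝ) * Real.pi) t := by
      simpa using (hasDerivAt_id t).const_mul (2 * (n : ℝ) * Real.pi)
    refine ((hd1.sin.log hs).mul (hd2.sin.div_const (2 * (n : ℝ) * Real.pi))).congr_deriv ?_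
    simp only [hsP]
    field_simp
    ring

theorem two_mul_integral_log_Gamma_mul_cos {n : ℕ} (hn : n ≠ 0) :
    2 * ∫ t in (0 : ℝ)..1, Real.log (Real.Gamma t) * Real.cos (2 * (n : ℝ) * Real.pi * t) =
      1 / (2 * (n : ℝ)) := by
  rw [two_mul_integral_log_Gamma_mul_of_symm (φ := fun t => Real.cos (2 * (n : ℝ) * Real.pi * t))
    (by fun_prop) fun t => ?_, integral_cos_two_mul_nat_mul_pi hn,
    integral_log_sin_pi_mul_mul_cos hn]
  · ring
  · rw [show 2 * (n : ℝ) * Real.pi * (1 - t) =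
      (n : ℝ) * (2 * Real.pi) - 2 * (n : ℝ) * Real.pi * t by ring, Real.cos_nat_mul_two_pi_sub]

/-! ### Sine coefficients of `log Γ` -/

/-- Integration by parts with the primitive `1 - cos (a t)` of `a sin (a t)`, which makes the
boundary term vanish at `0`. -/
theorem integral_log_mul_sin {a M : ℝ} (ha : a ≠ 0) (hM : 0 ≤ M) (hcos : Real.cos (a * M) = 1) :
    ∫ t in (0 : ℝ)..M, Real.log t * Real.sin (a * t) = -(cosIntegralEntire (a * M) / a) := by
  set G : ℝ → ℝ := fun t => (1 - Real.cos (a * t)) / a * Real.log t with hG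
  have hq : Continuous fun t => (1 - Real.cos (a * t)) / t := by
    refine ((continuous_one_sub_cos_div.comp (by fun_prop : Continuous fun t => a * t)).const_mul
      a).congr fun t => ?_
    rcases eq_or_ne t 0 with rfl | ht
    · simp
    · simp only [Function.comp]
      field_simp
  have hGc : Continuous G := by
    refine ((hq.mul Real.continuous_mul_log).div_const a).congr fun t => ?_
    rcases eq_or_ne t 0 with rfl | ht
    · simp [hG]
    · simp only [hG, Pi.mul_apply]
      field_simp
  have hint1 : IntervalIntegrable (fun t => Real.log t * Real.sin (a * t)) volume 0 M :=
    intervalIntegrable_log'.mul_continuousOn (by fun_prop)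
  have hint2 : IntervalIntegrable (fun t => 1 / a * ((1 - Real.cos (a * t)) / t)) volume 0 M :=
    (hq.const_mul _).intervalIntegrable _ _
  have hFTC := integral_eq_sub_of_hasDerivAt_of_le hM hGc.continuousOn
    (fun t ht => ?_) (hint1.add hint2)
  · rw [intervalIntegral.integral_add hint1 hint2, intervalIntegral.integral_const_mul,
      integral_one_sub_cos_mul_div ha] at hFTC
    have h0 : G 0 = 0 := by simp [hG]
    have h1 : G M = 0 := by simp [hG, hcos]
    rw [h0, h1] at hFTC
    rw [div_eq_mul_one_div]
    linarith
  · have hd : HasDerivAt (fun t => a * t) a t := by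
      simpa using (hasDerivAt_id t).const_mul a
    have ht0 : t ≠ 0 := ht.1.ne'
    refine (((hd.cos.const_sub 1).div_const a).mul (Real.hasDerivAt_log ht0)).congr_deriv ?_
    field_simp

theorem integral_id_mul_sin {a : ℝ} (ha : a ≠ 0) (hcos : Real.cos a = 1) (hsin : Real.sin a = 0) :
    ∫ t in (0 : ℝ)..1, t * Real.sin (a * t) = -(1 / a) := by
  rw [integral_eq_sub_of_hasDerivAt
    (f := fun t => Real.sin (a * t) / a / a - t * (Real.cos (a * t) / a)) (fun t _ => ?_)
    ((by fun_prop : Continuous _).intervalIntegrable _ _)]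
  · simp [hcos, hsin]
  · have hd : HasDerivAt (fun t => a * t) a t := by
      simpa using (hasDerivAt_id t).const_mul a
    refine (((hd.sin.div_const a).div_const a).sub
      ((hasDerivAt_id t).mul (hd.cos.div_const a))).congr_deriv ?_
    simp only [id]
    field_simp
    ring

open Real.BohrMollerup in
theorem intervalIntegrable_logGammaSeq (m : ℕ) :
    IntervalIntegrable (fun t => logGammaSeq t m) volume 0 1 := by
  have hlog : ∀ k : ℕ, IntervalIntegrable (fun t => Real.log (t + k)) volume 0 1 := fun k => by
    simpa using (intervalIntegrable_log' (a := 0 + k) (b := 1 + k)).comp_add_right (k : ℝ)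
  refine IntervalIntegrable.sub ((by fun_prop : Continuous fun t : ℝ =>
    t * Real.log m + Real.log (m.factorial : ℝ)).intervalIntegrable _ _) ?_
  simpa only [Finset.sum_fn] using IntervalIntegrable.sum (Finset.range (m + 1)) fun k _ => hlog k

open Real.BohrMollerup in
/-- The logarithms `log (t + k)` in `logGammaSeq` are unfolded over `[0, m + 1]` by the periodicity
of the sine. -/
theorem integral_logGammaSeq_mul_sin {n : ℕ} (hn : n ≠ 0) (m : ℕ) :
    ∫ t in (0 : ℝ)..1, logGammaSeq t m * Real.sin (2 * (n : ℝ) * Real.pi * t) =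
      (cosIntegralEntire (2 * (n : ℝ) * Real.pi * ((m : ℝ) + 1)) - Real.log m) /
        (2 * (n : ℝ) * Real.pi) := by
  set a : ℝ := 2 * (n : ℝ) * Real.pi with ha_def
  have ha : a ≠ 0 := by positivity
  have hsin_a : Real.sin a = 0 := by
    rw [ha_def]
    exact_mod_cast Real.sin_nat_mul_pi (2 * n)
  have hcosk : ∀ k : ℕ, Real.cos (a * k) = 1 := fun k => by
    rw [← Real.cos_nat_mul_two_pi (n * k), ha_def]
    push_cast
    ring_nf
  have hper : ∀ (k : ℕ) (t : ℝ), Real.sin (a * (t + k)) = Real.sin (a * t) := fun k t => by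
    rw [← Real.sin_add_nat_mul_two_pi (a * t) (n * k), ha_def]
    push_cast
    ring_nf
  have hlog : ∀ c d : ℝ, IntervalIntegrable (fun t => Real.log t * Real.sin (a * t)) volume c d :=
    fun c d => intervalIntegrable_log'.mul_continuousOn (by fun_prop)
  have hlogk : ∀ k : ℕ, IntervalIntegrable (fun t => Real.log (t + k) * Real.sin (a * t))
      volume 0 1 := fun k => by
    have := (hlog (0 + k) (1 + k)).comp_add_right (k : ℝ)
    simpa [hper] using this
  have hsum : ∑ k ∈ Finset.range (m + 1),
      ∫ t in (0 : ℝ)..1, Real.log (t + k) * Real.sin (a * t) =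
      ∫ t in (0 : ℝ)..((m : ℝ) + 1), Real.log t * Real.sin (a * t) := by
    have h := sum_integral_adjacent_intervals (a := fun k : ℕ => (k : ℝ)) (n := m + 1)
      fun k _ => hlog (k : ℝ) ((k + 1 : ℕ) : ℝ)
    push_cast at h
    rw [← h]
    refine Finset.sum_congr rfl fun k _ => ?_
    have h2 := intervalIntegral.integral_comp_add_right (a := 0) (b := 1)
      (fun t => Real.log t * Real.sin (a * t)) (k : ℝ)
    simp only [hper] at h2
    rw [h2, zero_add, add_comm (1 : ℝ)]
  have hM := integral_log_mul_sin ha (by positivity : (0 : ℝ) ≤ (m : ℝ) + 1)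
    (by exact_mod_cast hcosk (m + 1))
  have hcongr : ∫ t in (0 : ℝ)..1, logGammaSeq t m * Real.sin (a * t) =
      ∫ t in (0 : ℝ)..1, ((Real.log m * (t * Real.sin (a * t)) +
        Real.log (m.factorial : ℝ) * Real.sin (a * t)) -
          ∑ k ∈ Finset.range (m + 1), Real.log (t + k) * Real.sin (a * t)) := by
    refine integral_congr fun t _ => ?_
    simp only [logGammaSeq, ← Finset.sum_mul]
    ring
  have hsint : ∫ t in (0 : ℝ)..1, Real.sin (a * t) = 0 := integral_sin_two_mul_nat_mul_pi n
  rw [hcongr, intervalIntegral.integral_sub, intervalIntegral.integral_add,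
    intervalIntegral.integral_const_mul, intervalIntegral.integral_const_mul,
    integral_id_mul_sin ha (by simpa using hcosk 1) hsin_a, hsint,
    intervalIntegral.integral_finsetSum fun k _ => hlogk k, hsum, hM]
  · ring
  · exact (by fun_prop : Continuous _).intervalIntegrable _ _
  · exact (by fun_prop : Continuous _).intervalIntegrable _ _
  · exact (by fun_prop : Continuous _).intervalIntegrable _ _
  · simpa only [Finset.sum_fn] using
      IntervalIntegrable.sum (Finset.range (m + 1)) fun k _ => hlogk k

open Real.BohrMollerup in
/-- On `(0, 1]` the Euler sequence converges to `log Γ` uniformly. -/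
theorem abs_log_Gamma_sub_logGammaSeq_le {t : ℝ} (h0 : 0 < t) (h1 : t ≤ 1) {m : ℕ} (hm : m ≠ 0) :
    |Real.log (Real.Gamma t) - logGammaSeq t m| ≤ Real.log (m + 1) - Real.log m := by
  have hfeq : ∀ {y : ℝ}, 0 < y →
      (Real.log ∘ Real.Gamma) (y + 1) = (Real.log ∘ Real.Gamma) y + Real.log y := fun {y} hy => by
    rw [Function.comp_apply, Real.Gamma_add_one hy.ne',
      Real.log_mul hy.ne' (Real.Gamma_pos_of_pos hy).ne', add_comm, Function.comp_apply]
  have hle := le_logGammaSeq Real.convexOn_log_Gamma hfeq h0 h1 m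
  have hge := ge_logGammaSeq Real.convexOn_log_Gamma hfeq h0 hm
  simp only [Function.comp_apply, Real.Gamma_one, Real.log_one, zero_add] at hle hge
  have hm' : (0 : ℝ) < m := by positivity
  have hmono : Real.log m ≤ Real.log (m + 1) := Real.log_le_log hm' (by linarith)
  rw [abs_of_nonneg (by linarith)]
  nlinarith

open Real.BohrMollerup in
/-- With `a = 2 n π`, the sine integral of the `m`-th Euler approximation is
`(Cin (a (m + 1)) - log m) / a`, and `Cin (a (m + 1)) = log (a (m + 1)) + γ + o(1)`. -/
theorem two_mul_integral_log_Gamma_mul_sin {n : ℕ} (hn : n ≠ 0) :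
    2 * ∫ t in (0 : ℝ)..1, Real.log (Real.Gamma t) * Real.sin (2 * (n : ℝ) * Real.pi * t) =
      (Real.eulerMascheroniConstant + Real.log (2 * (n : ℝ) * Real.pi)) / ((n : ℝ) * Real.pi) := by
  have hn0 : (0 : ℝ) < n := by positivity
  have hpi := Real.pi_pos
  set a : ℝ := 2 * (n : ℝ) * Real.pi with ha_def
  have ha : 0 < a := by positivity
  have hlim1 : Tendsto (fun m : ℕ => ∫ t in (0 : ℝ)..1, logGammaSeq t m * Real.sin (a * t)) atTop
      (𝓝 (∫ t in (0 : ℝ)..1, Real.log (Real.Gamma t) * Real.sin (a * t))) := by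
    rw [tendsto_iff_norm_sub_tendsto_zero]
    refine squeeze_zero' (Eventually.of_forall fun _ => norm_nonneg _) ?_
      Real.tendsto_log_nat_add_one_sub_log
    filter_upwards [eventually_ne_atTop 0] with m hm
    rw [norm_sub_rev, ← intervalIntegral.integral_sub
      (intervalIntegrable_log_Gamma.mul_continuousOn (by fun_prop))
      ((intervalIntegrable_logGammaSeq m).mul_continuousOn (by fun_prop))]
    have h := norm_integral_le_of_norm_le_const (a := 0) (b := 1)
      (f := fun t => Real.log (Real.Gamma t) * Real.sin (a * t) -
        logGammaSeq t m * Real.sin (a * t)) (C := Real.log (m + 1) - Real.log m) fun t ht => by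
      rw [uIoc_of_le zero_le_one] at ht
      rw [← sub_mul, norm_mul]
      exact (mul_le_of_le_one_right (norm_nonneg _) (Real.abs_sin_le_one _)).trans
        (abs_log_Gamma_sub_logGammaSeq_le ht.1 ht.2 hm)
    simpa using h
  have hlim2 : Tendsto (fun m : ℕ => ∫ t in (0 : ℝ)..1, logGammaSeq t m * Real.sin (a * t)) atTop
      (𝓝 ((Real.eulerMascheroniConstant + Real.log a) / a)) := by
    have hM : Tendsto (fun m : ℕ => a * ((m : ℝ) + 1)) atTop atTop :=
      (tendsto_atTop_add_const_right _ _ tendsto_natCast_atTop_atTop).const_mul_atTop ha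
    have h := (((tendsto_cosIntegralEntire_sub_log.comp hM).add_const (Real.log a)).add
      Real.tendsto_log_nat_add_one_sub_log).div_const a
    rw [add_zero] at h
    refine h.congr fun m => ?_
    rw [integral_logGammaSeq_mul_sin hn, ← ha_def, Function.comp_apply,
      Real.log_mul ha.ne' (by positivity)]
    ring
  rw [tendsto_nhds_unique hlim1 hlim2, ha_def]
  field_simp

end

theorem mainTheorem2 :
    (∀ x : ℝ, 0 < x → x < 1 →
      Tendsto
        (fun N : ℕ => (1 / 2) * Real.log (2 * Real.pi) +
          ∑ n ∈ Finset.Icc 1 N,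
            (1 / (2 * (n : ℝ)) * Real.cos (2 * (n : ℝ) * Real.pi * x) +
              (Real.eulerMascheroniConstant + Real.log (2 * (n : ℝ) * Real.pi)) /
                ((n : ℝ) * Real.pi) * Real.sin (2 * (n : ℝ) * Real.pi * x)))
        atTop (𝓝 (Real.log (Real.Gamma x)))) ∧
    (∀ y : ℝ, 0 < y →
      Tendsto (fun T : ℝ => -∫ t in y..T, Real.cos t / t) atTop (𝓝 (cosIntegral y))) ∧
    Tendsto (fun y : ℝ => Real.cos y * cosIntegral y - Real.log y) (𝓝[>] 0)
      (𝓝 Real.eulerMascheroniConstant) := by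
  refine ⟨fun x hx0 hx1 => ?_, fun y hy => ?_, tendsto_cos_mul_cosIntegral_sub_log⟩
  · refine (tendsto_fourierPartialSum_of_differentiableAt intervalIntegrable_log_Gamma hx0 hx1
      (differentiableAt_log_Gamma hx0)).congr fun N => ?_
    rw [integral_log_Gamma]
    refine congrArg _ (Finset.sum_congr rfl fun n hn => ?_)
    have hn0 : n ≠ 0 := by have := (Finset.mem_Icc.1 hn).1; omega
    rw [two_mul_integral_log_Gamma_mul_cos hn0, two_mul_integral_log_Gamma_mul_sin hn0]
  · rw [cosIntegral_eq hy]
    exact tendsto_neg_integral_cos_div hy
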